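/- Let $q,r\in\mathbb{C}\setminus\{0\}$ and $\delta\in\mathbb{C}$ with $r-r^{-1}=\delta(q-q^{-1})$ (so $\delta=\frac{r-r^{-1}}{q-q^{-1}}$ if $q\neq\pm1$, while for $q=\pm1$ the circle parameter $\delta$ is a further parameter). A HOMFLY-PT diagram is an oriented tangle diagram in a disc with a marked boundary point, up to planar isotopy relative to the boundary. The HOMFLY-PT planar algebra $\mathscr{P}^H_\bullet(q,r)=\mathscr{P}^H_\bullet(q,r;\delta)$ is the shaded planar algebra over $\mathbb{C}$ in which $\mathscr{P}^H_{n,\pm}$ is the vector space of formal linear combinations of HOMFLY-PT diagrams with $2n$ boundary points of alternating orientation (the sign $\pm$ fixes the orientation at the first boundary point), modulo the following relations, applied locally inside of diagrams: (positive crossing) $-$ (negative crossing) $=(q-q^{-1})\,$(two parallel strings); a positive kink is removed at the price of a factor $r$ and a negative kink at the price of a factor $r^{-1}$; the Reidemeister moves II (for all orientations) and III; a circle of either orientation is removed at the price of a factor $\delta$. Shaded planar tangles act by gluing diagrams into their input discs. An isomorphism of planar algebras is a family of linear isomorphisms of the spaces with index $(n,\pm)$ that commutes with the action of all shaded planar tangles.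 Then the four planar algebras $\mathscr{P}^H_\bullet(q,r)$, $\mathscr{P}^H_\bullet(-q^{-1},r)$, $\mathscr{P}^H_\bullet(-q,-r)$ and $\mathscr{P}^H_\bullet(q^{-1},r^{-1})$, all with the same circle parameter $\delta$, are isomorphic. More precisely: 1. there is an isomorphism $\mathscr{P}^H_\bullet(q,r)\to\mathscr{P}^H_\bullet(-q^{-1},r)$ that sends the class of every diagram $D$ to the class of $D$; 2. there is an isomorphism $\mathscr{P}^H_\bullet(q,r)\to\mathscr{P}^H_\bullet(-q,-r)$ that negates the crossings, that is, it sends the class of $D$ to $(-1)^{c(D)}$ times the class of $D$, where $c(D)$ is the number of crossings of $D$; 3. there is an isomorphism $\mathscr{P}^H_\bullet(q,r)\to\mathscr{P}^H_\bullet(q^{-1},r^{-1})$ that sends the class of $D$ to the class of the diagram in which every crossing of $D$ is replaced by the opposite crossing. -/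

import Mathlib

/-! # Oriented planar diagrams, shaded planar algebras, and the HOMFLY-PT planar algebra

A planar diagram in a disc with a marked boundary point is cut open at the marked point, so that
it becomes a diagram in a half plane with all its boundary points on a line.  It is written as the
list of its elementary horizontal layers, read from bottom to top. -/

namespace Homfly

/-- The orientations of the strings that meet a horizontal line, from left to right;
`true` is upwards, `false` is downwards. -/
abbrev Word := List Bool

/-- The word read after a rotation by `π`. -/
def dual : Word → Word
  | [] => []
  | b :: w => dual w ++ [!b]

/-- An elementary piece of a diagram: a local minimum of a string, a local maximum of a string,
or a vertex (box) labelled by `i`, with all its legs leaving through its top and with its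
marked point at the left of its first leg. -/
inductive Piece (ι : Type) : Type
  | cup (b : Bool)
  | cap (b : Bool)
  | box (i : ι)

section Diagrams

variable {ι κ : Type}

/-- The word below an elementary piece. -/
def Piece.source : Piece ι → Word
  | .cup _ => []
  | .cap b => [!b, b]
  | .box _ => []

/-- The word above an elementary piece; `bd i` is the word of the legs of a box with label `i`. -/
def Piece.target (bd : ι → Word) : Piece ι → Word
  | .cup b => [!b, b]
  | .cap _ => []
  | .box i => bd i

/-- A horizontal layer: one elementary piece with vertical strings on its left and right. -/
@[ext] structure Layer (ι : Type) : Type where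
  left : Word
  piece : Piece ι
  right : Word

def Layer.source (L : Layer ι) : Word := L.left ++ (L.piece.source ++ L.right)

def Layer.target (bd : ι → Word) (L : Layer ι) : Word := L.left ++ (L.piece.target bd ++ L.right)

/-- The layers of the list fit on top of each other, from the word `a` up to the word `b`. -/
def IsPath (bd : ι → Word) : Word → List (Layer ι) → Word → Prop
  | a, [], b => a = b
  | a, L :: Ls, b => a = L.source ∧ IsPath bd (L.target bd) Ls b

theorem IsPath.append {bd : ι → Word} {a b c : Word} {l₁ l₂ : List (Layer ι)}
    (h₁ : IsPath bd a l₁ b) (h₂ : IsPath bd b l₂ c) : IsPath bd a (l₁ ++ l₂) c := by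
  induction l₁ generalizing a with
  | nil => cases h₁; exact h₂
  | cons L Ls ih => exact ⟨h₁.1, ih h₁.2⟩

/-- Add vertical strings on the left. -/
def Layer.addLeft (l : Word) (L : Layer ι) : Layer ι := ⟨l ++ L.left, L.piece, L.right⟩

/-- Add vertical strings on the right. -/
def Layer.addRight (r : Word) (L : Layer ι) : Layer ι := ⟨L.left, L.piece, L.right ++ r⟩

theorem IsPath.addLeft {bd : ι → Word} (l : Word) {a b : Word} {Ls : List (Layer ι)}
    (h : IsPath bd a Ls b) : IsPath bd (l ++ a) (Ls.map (Layer.addLeft l)) (l ++ b) := by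
  induction Ls generalizing a with
  | nil => cases h; rfl
  | cons L Ls ih =>
    refine ⟨?_, ?_⟩
    · rw [h.1]; simp [Layer.source, Layer.addLeft]
    · have := ih h.2
      simpa [Layer.target, Layer.addLeft] using this

theorem IsPath.addRight {bd : ι → Word} (r : Word) {a b : Word} {Ls : List (Layer ι)}
    (h : IsPath bd a Ls b) : IsPath bd (a ++ r) (Ls.map (Layer.addRight r)) (b ++ r) := by
  induction Ls generalizing a with
  | nil => cases h; rfl
  | cons L Ls ih =>
    refine ⟨?_, ?_⟩
    · rw [h.1]; simp [Layer.source, Layer.addRight]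
    · have := ih h.2
      simpa [Layer.target, Layer.addRight] using this

/-- A planar diagram of oriented strings and labelled boxes in a horizontal strip, with bottom
boundary word `a` and top boundary word `b`. -/
@[ext] structure Diagram (bd : ι → Word) (a b : Word) : Type where
  layers : List (Layer ι)
  isPath : IsPath bd a layers b

namespace Diagram

variable {bd : ι → Word}

/-- Vertical strings. -/
def id (a : Word) : Diagram bd a a := ⟨[], rfl⟩

/-- Stack the second diagram on top of the first one. -/
def comp {a b c : Word} (D : Diagram bd a b) (E : Diagram bd b c) : Diagram bd a c :=
  ⟨D.layers ++ E.layers, D.isPath.append E.isPath⟩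

def addLeft (l : Word) {a b : Word} (D : Diagram bd a b) : Diagram bd (l ++ a) (l ++ b) :=
  ⟨D.layers.map (Layer.addLeft l), D.isPath.addLeft l⟩

def addRight (r : Word) {a b : Word} (D : Diagram bd a b) : Diagram bd (a ++ r) (b ++ r) :=
  ⟨D.layers.map (Layer.addRight r), D.isPath.addRight r⟩

def cast {a b a' b' : Word} (D : Diagram bd a b) (ha : a = a') (hb : b = b') :
    Diagram bd a' b' := ⟨D.layers, ha ▸ hb ▸ D.isPath⟩

def cup (b : Bool) : Diagram bd [] [!b, b] :=
  ⟨[⟨[], .cup b, []⟩], by simp [IsPath, Layer.source, Layer.target, Piece.source, Piece.target]⟩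

def cap (b : Bool) : Diagram bd [!b, b] [] :=
  ⟨[⟨[], .cap b, []⟩], by simp [IsPath, Layer.source, Layer.target, Piece.source, Piece.target]⟩

def box (i : ι) : Diagram bd [] (bd i) :=
  ⟨[⟨[], .box i, []⟩], by simp [IsPath, Layer.source, Layer.target, Piece.source, Piece.target]⟩

/-- A string with one minimum and, on its left, one maximum. -/
def zigzagLeft (b : Bool) : Diagram bd [b] [b] :=
  ⟨[⟨[b], .cup b, []⟩, ⟨[], .cap (!b), [b]⟩], by
    simp [IsPath, Layer.source, Layer.target, Piece.source, Piece.target]⟩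

/-- A string with one minimum and, on its right, one maximum. -/
def zigzagRight (b : Bool) : Diagram bd [b] [b] :=
  ⟨[⟨[], .cup (!b), [b]⟩, ⟨[b], .cap b, []⟩], by
    simp [IsPath, Layer.source, Layer.target, Piece.source, Piece.target]⟩

/-- Nested minima. -/
def cups : ∀ w : Word, Diagram bd [] (dual w ++ w)
  | [] => id []
  | b :: w => (cups w).comp ((((cup b).addRight w).addLeft (dual w)).cast rfl (by simp [dual]))

/-- Nested maxima. -/
def caps : ∀ w : Word, Diagram bd (dual w ++ w) []
  | [] => id []
  | b :: w => ((((cap b).addRight w).addLeft (dual w)).cast (by simp [dual]) rfl).comp (caps w)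

/-- The diagram with its top boundary turned around by a full `2π` rotation: all of
the strings leave through the top, turn to the left, run below the diagram, and
return to the top on the right of it. -/
def rotate {w : Word} (D : Diagram bd [] w) : Diagram bd [] w :=
  ((cups w).comp ((D.addRight w).addLeft (dual w))).comp
    (((caps w).addRight w).cast (by simp) rfl)

/-- Insert a diagram between `pre` and `post`, with vertical strings on its left and right. -/
def insert {a b u v : Word} (D : Diagram bd a b) (l r : Word)
    (pre : Diagram bd u (l ++ (a ++ r))) (post : Diagram bd (l ++ (b ++ r)) v) :
    Diagram bd u v :=
  pre.comp (((D.addRight r).addLeft l).comp post)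

/-- The labels of the boxes, from bottom to top. -/
def labels {a b : Word} (D : Diagram bd a b) : List ι :=
  D.layers.filterMap fun L => match L.piece with
    | .box i => some i
    | _ => none

/-- Change of labels. -/
def _root_.Homfly.Layer.relabel (f : ι → κ) (L : Layer ι) : Layer κ :=
  ⟨L.left, match L.piece with
    | .cup b => .cup b
    | .cap b => .cap b
    | .box i => .box (f i), L.right⟩

theorem _root_.Homfly.Layer.relabel_source (f : ι → κ) (L : Layer ι) :
    (L.relabel f).source = L.source := by
  rcases L with ⟨l, _ | _ | _, r⟩ <;> rfl

theorem _root_.Homfly.Layer.relabel_target (bd : κ → Word) (f : ι → κ) (L : Layer ι) :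
    (L.relabel f).target bd = L.target (fun i => bd (f i)) := by
  rcases L with ⟨l, _ | _ | _, r⟩ <;> rfl

theorem _root_.Homfly.IsPath.relabel {bd : κ → Word} (f : ι → κ) {a b : Word}
    {Ls : List (Layer ι)} (h : IsPath (fun i => bd (f i)) a Ls b) :
    IsPath bd a (Ls.map (Layer.relabel f)) b := by
  induction Ls generalizing a with
  | nil => exact h
  | cons L Ls ih =>
    refine ⟨by rw [h.1, Layer.relabel_source], ?_⟩
    rw [Layer.relabel_target]; exact ih h.2

def relabel {bd : κ → Word} (f : ι → κ) {a b : Word} (D : Diagram (fun i => bd (f i)) a b) :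
    Diagram bd a b := ⟨D.layers.map (Layer.relabel f), D.isPath.relabel f⟩

/-- Replace a box in a layer by a diagram. -/
def _root_.Homfly.Layer.subst {bd : ι → Word} {bd' : κ → Word}
    (D : ∀ i, Diagram bd' [] (bd i)) (L : Layer ι) : List (Layer κ) :=
  match L.piece with
  | .cup b => [⟨L.left, .cup b, L.right⟩]
  | .cap b => [⟨L.left, .cap b, L.right⟩]
  | .box i => (((D i).addRight L.right).addLeft L.left).layers

theorem _root_.Homfly.Layer.isPath_subst {bd : ι → Word} {bd' : κ → Word}
    (D : ∀ i, Diagram bd' [] (bd i)) (L : Layer ι) :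
    IsPath bd' L.source (L.subst D) (L.target bd) := by
  rcases L with ⟨l, b | b | i, r⟩
  · exact ⟨rfl, rfl⟩
  · exact ⟨rfl, rfl⟩
  · exact (((D i).addRight r).addLeft l).isPath

theorem _root_.Homfly.IsPath.subst {bd : ι → Word} {bd' : κ → Word}
    (D : ∀ i, Diagram bd' [] (bd i)) {a b : Word} {Ls : List (Layer ι)} (h : IsPath bd a Ls b) :
    IsPath bd' a (Ls.flatMap (Layer.subst D)) b := by
  induction Ls generalizing a with
  | nil => exact h
  | cons L Ls ih =>
    rw [List.flatMap_cons, h.1]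
    exact (L.isPath_subst D).append (ih h.2)

/-- Replace every box with label `i` by the diagram `D i`. -/
def subst {bd : ι → Word} {bd' : κ → Word} {a b : Word} (T : Diagram bd a b)
    (D : ∀ i, Diagram bd' [] (bd i)) : Diagram bd' a b :=
  ⟨T.layers.flatMap (Layer.subst D), T.isPath.subst D⟩

end Diagram

/-- The local moves of planar isotopy: the heights of two neighbouring
diagrams are exchanged, a string is straightened, a diagram all of whose strings leave through
the top is rotated by `2π`. -/
inductive LocalIsotopy {bd : ι → Word} : ∀ {a b : Word}, Diagram bd a b → Diagram bd a b → Prop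
  | exchange {a b a' b' : Word} (D : Diagram bd a b) (E : Diagram bd a' b') :
      LocalIsotopy ((D.addRight a').comp (E.addLeft b)) ((E.addLeft a).comp (D.addRight b'))
  | zigzagLeft (b : Bool) : LocalIsotopy (Diagram.zigzagLeft b) (Diagram.id [b])
  | zigzagRight (b : Bool) : LocalIsotopy (Diagram.zigzagRight b) (Diagram.id [b])
  | rotate {w : Word} (D : Diagram bd [] w) : LocalIsotopy D.rotate D

/-- Planar isotopy relative to the boundary: the equivalence relation that is generated by the
local moves inside of larger diagrams. -/
def Isotopic {bd : ι → Word} {u v : Word} : Diagram bd u v → Diagram bd u v → Prop :=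
  Relation.EqvGen fun D D' => ∃ (a b l r : Word) (pre : Diagram bd u (l ++ (a ++ r)))
    (post : Diagram bd (l ++ (b ++ r)) v) (A B : Diagram bd a b),
    LocalIsotopy A B ∧ D = A.insert l r pre post ∧ D' = B.insert l r pre post

end Diagrams

/-! ## Shaded planar tangles and planar algebras -/

/-- The type of a disc: it has `2n` boundary points, and the shading of its marked region. -/
abbrev Color := ℕ × Bool

/-- The alternating word of length `2n` that starts with `σ`.  The strings of shaded tangles are
oriented such that a string with a region of shading `true` on its left and a region of
shading `false` on its right is oriented upwards. -/
def altWord (σ : Bool) : ℕ → Word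
  | 0 => []
  | n + 1 => σ :: (!σ) :: altWord σ n

def Color.word (c : Color) : Word := altWord c.2 c.1

/-- The orientations alternate, starting with `σ`. -/
def Alternates : Bool → Word → Prop
  | _, [] => True
  | σ, b :: w => b = σ ∧ Alternates (!σ) w

/-- The shading on the right of a word, when it is `σ` on the left. -/
def shadeAfter (σ : Bool) : Word → Bool
  | [] => σ
  | _ :: w => shadeAfter (!σ) w

/-- Each horizontal line meets the strings in alternating orientation, that is, the regions are
shaded as a checkerboard with `σ` at the marked boundary point; and the marked
region of each disc has the shading that the type of the disc says. -/
def IsShaded {ι : Type} (shade : ι → Bool) (σ : Bool) (Ls : List (Layer ι)) : Prop :=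
  ∀ L ∈ Ls, Alternates σ L.source ∧ ∀ i, L.piece = .box i → shade i = shadeAfter σ L.left

/-- A shaded planar tangle with input discs of types `c i`, and output disc of type `o`. -/
structure PlanarTangle {ι : Type} (c : ι → Color) (o : Color) : Type where
  diagram : Diagram (fun i => (c i).word) [] o.word
  shaded : IsShaded (fun i => (c i).2) o.2 diagram.layers
  labels_nodup : diagram.labels.Nodup
  mem_labels : ∀ i, i ∈ diagram.labels

/-! ### Composition of tangles -/

section Lemmas

variable {ι κ : Type}

theorem alternates_append (σ : Bool) (a b : Word) :
    Alternates σ (a ++ b) ↔ Alternates σ a ∧ Alternates (shadeAfter σ a) b := by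
  induction a generalizing σ with
  | nil => simp [Alternates, shadeAfter]
  | cons x a ih => simp [Alternates, shadeAfter, ih, and_assoc]

theorem shadeAfter_append (σ : Bool) (a b : Word) :
    shadeAfter σ (a ++ b) = shadeAfter (shadeAfter σ a) b := by
  induction a generalizing σ with
  | nil => rfl
  | cons x a ih => simp [shadeAfter, ih]

theorem shadeAfter_of_even (σ : Bool) : ∀ a : Word, Even a.length → shadeAfter σ a = σ
  | [], _ => rfl
  | [_], h => by simp at h
  | _ :: _ :: a, h => by
    have h' : Even a.length := by simpa [Nat.even_add_one, parity_simps] using h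
    simp [shadeAfter, shadeAfter_of_even σ a h']

theorem alternates_altWord (σ : Bool) (n : ℕ) : Alternates σ (altWord σ n) := by
  induction n with
  | zero => trivial
  | succ n ih => simp [altWord, Alternates, ih]

theorem even_length_altWord (σ : Bool) (n : ℕ) : Even (altWord σ n).length := by
  induction n with
  | zero => simp [altWord]
  | succ n ih => simpa [altWord, Nat.even_add_one, parity_simps] using ih

theorem even_target_iff {bd : ι → Word} (hbd : ∀ i, Even (bd i).length) (L : Layer ι) :
    Even (L.target bd).length ↔ Even L.source.length := by
  rcases L with ⟨l, b | b | i, r⟩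
  · simp [Layer.source, Layer.target, Piece.source, Piece.target, parity_simps]
  · simp [Layer.source, Layer.target, Piece.source, Piece.target, parity_simps]
  · have := hbd i
    simp only [Layer.source, Layer.target, Piece.source, Piece.target, List.length_append,
      List.length_nil, Nat.even_add]
    simp [this]

theorem IsPath.even_source {bd : ι → Word} (hbd : ∀ i, Even (bd i).length) {a b : Word}
    {Ls : List (Layer ι)} (h : IsPath bd a Ls b) (ha : Even a.length) :
    ∀ L ∈ Ls, Even L.source.length := by
  induction Ls generalizing a with
  | nil => simp
  | cons L Ls ih =>
    intro L' hL'
    have hs : Even L.source.length := h.1 ▸ ha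
    rcases List.mem_cons.1 hL' with rfl | hL'
    · exact hs
    · exact ih h.2 ((even_target_iff hbd L).2 hs) L' hL'

theorem isShaded_subst {bd : ι → Word} {bd' : κ → Word} {shade : ι → Bool} {shade' : κ → Bool}
    {σ : Bool} {Ls : List (Layer ι)} (h : IsShaded shade σ Ls)
    (hbd' : ∀ i, Even (bd' i).length) (D : ∀ i, Diagram bd' [] (bd i))
    (hD : ∀ i, IsShaded shade' (shade i) (D i).layers) :
    IsShaded shade' σ (Ls.flatMap (Layer.subst D)) := by
  intro L hL
  obtain ⟨K, hK, hLK⟩ := List.mem_flatMap.1 hL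
  obtain ⟨hK1, hK2⟩ := h K hK
  rcases K with ⟨l, b | b | i, r⟩
  · obtain rfl := List.mem_singleton.1 hLK
    exact ⟨hK1, by simp⟩
  · obtain rfl := List.mem_singleton.1 hLK
    exact ⟨hK1, by simp⟩
  · have hs : shade i = shadeAfter σ l := hK2 i rfl
    simp only [Layer.subst, Diagram.addLeft, Diagram.addRight, List.map_map,
      List.mem_map] at hLK
    obtain ⟨M, hM, rfl⟩ := hLK
    obtain ⟨hM1, hM2⟩ := hD i M hM
    have hev := (D i).isPath.even_source hbd' (by simp) M hM
    have hK1' : Alternates σ l ∧ Alternates (shade i) r := by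
      simpa [Layer.source, Piece.source, alternates_append, hs] using hK1
    have hsrc : (Layer.addLeft l (Layer.addRight r M)).source = l ++ (M.source ++ r) := by
      simp [Layer.source, Layer.addLeft, Layer.addRight]
    refine ⟨?_, fun j hj => ?_⟩
    · rw [Function.comp_apply, hsrc, alternates_append, alternates_append, ← hs]
      exact ⟨hK1'.1, hM1, by rw [shadeAfter_of_even _ _ hev]; exact hK1'.2⟩
    · have : (Layer.addLeft l (Layer.addRight r M)).left = l ++ M.left := rfl
      rw [Function.comp_apply, this, shadeAfter_append, ← hs]
      exact hM2 j hj

theorem isShaded_relabel {shade : κ → Bool} {σ : Bool} (f : ι → κ) {Ls : List (Layer ι)}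
    (h : IsShaded (fun i => shade (f i)) σ Ls) : IsShaded shade σ (Ls.map (Layer.relabel f)) := by
  intro L hL
  obtain ⟨K, hK, rfl⟩ := List.mem_map.1 hL
  obtain ⟨h1, h2⟩ := h K hK
  refine ⟨by rw [Layer.relabel_source]; exact h1, ?_⟩
  rcases K with ⟨l, b | b | i, r⟩
  · simp [Layer.relabel]
  · simp [Layer.relabel]
  · intro j hj
    obtain rfl : f i = j := by simpa [Layer.relabel] using hj
    exact h2 i rfl

/-- The label of the box in a layer. -/
def Layer.label? (L : Layer ι) : Option ι := match L.piece with
    | .box i => some i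
    | _ => none

theorem Diagram.labels_eq {bd : ι → Word} {a b : Word} (D : Diagram bd a b) :
    D.labels = D.layers.filterMap Layer.label? := rfl

theorem Diagram.labels_addLeft {bd : ι → Word} {a b : Word} (l : Word) (D : Diagram bd a b) :
    (D.addLeft l).labels = D.labels := by
  simp only [Diagram.labels_eq, Diagram.addLeft, List.filterMap_map]; rfl

theorem Diagram.labels_addRight {bd : ι → Word} {a b : Word} (l : Word) (D : Diagram bd a b) :
    (D.addRight l).labels = D.labels := by
  simp only [Diagram.labels_eq, Diagram.addRight, List.filterMap_map]; rfl

theorem Diagram.labels_subst {bd : ι → Word} {bd' : κ → Word} {a b : Word} (T : Diagram bd a b)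
    (D : ∀ i, Diagram bd' [] (bd i)) :
    (T.subst D).labels = T.labels.flatMap fun i => (D i).labels := by
  simp only [Diagram.labels_eq, Diagram.subst]
  induction T.layers with
  | nil => rfl
  | cons L Ls ih =>
    rw [List.flatMap_cons, List.filterMap_append, ih]
    rcases L with ⟨l, b | b | i, r⟩
    · rfl
    · rfl
    · have h1 : List.filterMap Layer.label? (Layer.subst D ⟨l, .box i, r⟩) = (D i).labels :=
        (Diagram.labels_addLeft l ((D i).addRight r)).trans (Diagram.labels_addRight r (D i))
      rw [h1]; rfl

theorem Diagram.labels_relabel {bd : κ → Word} (f : ι → κ) {a b : Word}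
    (D : Diagram (fun i => bd (f i)) a b) : (D.relabel f).labels = D.labels.map f := by
  simp only [Diagram.labels_eq, Diagram.relabel, List.filterMap_map, List.map_filterMap]
  congr 1
  funext L
  rcases L with ⟨l, b | b | i, r⟩ <;> rfl

end Lemmas

namespace PlanarTangle

/-- The identity tangle. -/
def id (o : Color) : PlanarTangle (fun _ : Unit => o) o where
  diagram := Diagram.box ()
  shaded := by
    intro L hL
    obtain rfl := List.mem_singleton.1 hL
    exact ⟨trivial, fun _ _ => rfl⟩
  labels_nodup := List.nodup_singleton ()
  mem_labels _ := List.mem_singleton.2 rfl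

/-- Glue a tangle into every input disc. -/
def comp {ι : Type} {κ : ι → Type} {c : ι → Color} {o : Color} {d : ∀ i, κ i → Color}
    (T : PlanarTangle c o) (S : ∀ i, PlanarTangle (d i) (c i)) :
    PlanarTangle (fun x : Σ i, κ i => d x.1 x.2) o where
  diagram := T.diagram.subst fun i =>
    Diagram.relabel (bd := fun x : Σ i, κ i => (d x.1 x.2).word) (Sigma.mk i) (S i).diagram
  shaded := isShaded_subst T.shaded
    (fun _ => even_length_altWord _ _) _ fun i =>
      isShaded_relabel (shade := fun x : Σ i, κ i => (d x.1 x.2).2) (Sigma.mk i) (S i).shaded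
  labels_nodup := by
    rw [Diagram.labels_subst, List.nodup_flatMap]
    refine ⟨fun i _ => ?_, T.labels_nodup.imp fun {i j} hij => ?_⟩
    · rw [Diagram.labels_relabel]
      exact (S i).labels_nodup.map sigma_mk_injective
    · simp only [Function.onFun, Diagram.labels_relabel]
      intro x hx hy
      obtain ⟨_, _, rfl⟩ := List.mem_map.1 hx
      obtain ⟨_, _, h⟩ := List.mem_map.1 hy
      exact hij (congrArg Sigma.fst h).symm
  mem_labels := by
    rintro ⟨i, j⟩
    rw [Diagram.labels_subst, List.mem_flatMap]
    exact ⟨i, T.mem_labels i, by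
      rw [Diagram.labels_relabel]; exact List.mem_map_of_mem ((S i).mem_labels j)⟩

/-- Rename the input discs. -/
def relabel {ι κ : Type} (e : ι ≃ κ) {c : κ → Color} {o : Color}
    (T : PlanarTangle (fun i => c (e i)) o) : PlanarTangle c o where
  diagram := Diagram.relabel (bd := fun j => (c j).word) e T.diagram
  shaded := isShaded_relabel (shade := fun j => (c j).2) e T.shaded
  labels_nodup := by
    rw [Diagram.labels_relabel]; exact T.labels_nodup.map e.injective
  mem_labels j := by
    rw [Diagram.labels_relabel]
    exact List.mem_map.2 ⟨e.symm j, T.mem_labels _, e.apply_symm_apply j⟩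

end PlanarTangle

/-- A (shaded) planar algebra over `ℂ`: the spaces `P_{n,±}`, and the action of the planar tangles
on them by multilinear maps, invariant under isotopy and renaming of the discs, and compatible
with gluing. -/
structure PlanarAlgebra : Type 1 where
  space : Color → Type
  [addCommGroup : ∀ c, AddCommGroup (space c)]
  [module : ∀ c, Module ℂ (space c)]
  act : ∀ {ι : Type} [Finite ι] {c : ι → Color} {o : Color}, PlanarTangle c o →
    MultilinearMap ℂ (fun i => space (c i)) (space o)
  act_isotopy : ∀ {ι : Type} [Finite ι] {c : ι → Color} {o : Color} (T T' : PlanarTangle c o),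
    Isotopic T.diagram T'.diagram → act T = act T'
  act_relabel : ∀ {ι κ : Type} [Finite ι] [Finite κ] (e : ι ≃ κ) {c : κ → Color} {o : Color}
    (T : PlanarTangle (fun i => c (e i)) o) (v : ∀ j, space (c j)),
    act (T.relabel e) v = act T fun i => v (e i)
  act_id : ∀ (o : Color) (v : Unit → space o), act (PlanarTangle.id o) v = v ()
  act_comp : ∀ {ι : Type} {κ : ι → Type} [Finite ι] [∀ i, Finite (κ i)] {c : ι → Color}
    {o : Color} {d : ∀ i, κ i → Color} (T : PlanarTangle c o)
    (S : ∀ i, PlanarTangle (d i) (c i)) (v : ∀ x : Σ i, κ i, space (d x.1 x.2)),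
    act (T.comp S) v = act T fun i => act (S i) fun j => v ⟨i, j⟩

attribute [instance] PlanarAlgebra.addCommGroup PlanarAlgebra.module

/-- An isomorphism of planar algebras: linear isomorphisms of the spaces that commute with the
action of every planar tangle. -/
structure PlanarAlgebra.Iso (P Q : PlanarAlgebra) : Type 1 where
  equiv : ∀ c, P.space c ≃ₗ[ℂ] Q.space c
  equiv_act : ∀ {ι : Type} [Finite ι] {c : ι → Color} {o : Color} (T : PlanarTangle c o)
    (v : ∀ i, P.space (c i)),
    equiv o (P.act T v) = Q.act T fun i => equiv (c i) (v i)

/-! ## The HOMFLY-PT skein relations -/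

/-- A crossing is a box with four legs: two that are oriented out of it, followed clockwise by two
that are oriented into it.  The label `true` is the positive crossing, and `false` is the
negative crossing. -/
def crossingWord (_ : Bool) : Word := [true, true, false, false]

/-- A HOMFLY-PT diagram: an oriented tangle diagram. -/
abbrev HDiagram (a b : Word) : Type := Diagram crossingWord a b

/-- The number of crossings. -/
def HDiagram.crossings {a b : Word} (D : HDiagram a b) : ℕ := D.labels.length

/-- Replace every crossing by the opposite one. -/
def HDiagram.mirror {a b : Word} (D : HDiagram a b) : HDiagram a b :=
  Diagram.relabel (bd := crossingWord) (fun s => !s) D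

/-- The crossing in its upright position, with two strings that run upwards. -/
def crossing (s : Bool) : HDiagram [true, true] [true, true] :=
  ((Diagram.box (bd := crossingWord) s).addRight [true, true]).comp
    ((((Diagram.cap true).addRight [true]).addLeft [true, true, false]).comp
      ((Diagram.cap true).addLeft [true, true]))

/-- The crossing rotated by a quarter turn: an upward string runs from the right to the left and
crosses a downward string. -/
def crossingRL (s : Bool) : HDiagram [false, true] [true, false] :=
  ((Diagram.cup false).addLeft [false, true]).comp
    ((((crossing s).addRight [false]).addLeft [false]).comp
      ((Diagram.cap true).addRight [true, false]))

/-- The crossing rotated by a quarter turn in the other direction: an upward string runs from the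
left to the right and crosses a downward string. -/
def crossingLR (s : Bool) : HDiagram [true, false] [false, true] :=
  ((Diagram.cup true).addRight [true, false]).comp
    ((((crossing s).addRight [false]).addLeft [false]).comp
      ((Diagram.cap false).addLeft [false, true]))

/-- An upward string with a kink on its right. -/
def kinkRight (s : Bool) : HDiagram [true] [true] :=
  ((Diagram.cup false).addLeft [true]).comp
    (((crossing s).addRight [false]).comp ((Diagram.cap false).addLeft [true]))

/-- An upward string with a kink on its left. -/
def kinkLeft (s : Bool) : HDiagram [true] [true] :=
  ((Diagram.cup true).addRight [true]).comp
    (((crossing s).addLeft [false]).comp ((Diagram.cap true).addRight [true]))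

/-- The two sides of the third Reidemeister move. -/
def braidLeft (s : Bool) : HDiagram [true, true, true] [true, true, true] :=
  ((crossing s).addRight [true]).comp
    (((crossing s).addLeft [true]).comp ((crossing s).addRight [true]))

def braidRight (s : Bool) : HDiagram [true, true, true] [true, true, true] :=
  ((crossing s).addLeft [true]).comp
    (((crossing s).addRight [true]).comp ((crossing s).addLeft [true]))

/-- A circle; the two orientations. -/
def circle (b : Bool) : HDiagram [] [] := (Diagram.cup b).comp (Diagram.cap b)

noncomputable section

/-- A diagram as a basis vector of the space of formal linear combinations of diagrams. -/
def lin {a b : Word} (D : HDiagram a b) : HDiagram a b →₀ ℂ := Finsupp.single D 1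

/-- The local HOMFLY-PT relations.  (With planar isotopy, they imply the same relations in
all other rotated positions.) -/
inductive SkeinRel (q r δ : ℂ) : ∀ {a b : Word}, (HDiagram a b →₀ ℂ) → Prop
  | isotopy {a b : Word} {D D' : HDiagram a b} (h : LocalIsotopy D D') :
      SkeinRel q r δ (lin D - lin D')
  | hecke : SkeinRel q r δ
      (lin (crossing true) - lin (crossing false) - (q - q⁻¹) • lin (Diagram.id [true, true]))
  | kinkRight_pos : SkeinRel q r δ (lin (kinkRight true) - r • lin (Diagram.id [true]))
  | kinkRight_neg : SkeinRel q r δ (lin (kinkRight false) - r⁻¹ • lin (Diagram.id [true]))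
  | kinkLeft_pos : SkeinRel q r δ (lin (kinkLeft true) - r • lin (Diagram.id [true]))
  | kinkLeft_neg : SkeinRel q r δ (lin (kinkLeft false) - r⁻¹ • lin (Diagram.id [true]))
  | reidemeister_two (s : Bool) : SkeinRel q r δ
      (lin ((crossing s).comp (crossing (!s))) - lin (Diagram.id [true, true]))
  | reidemeister_two_RL (s : Bool) : SkeinRel q r δ
      (lin ((crossingRL s).comp (crossingLR (!s))) - lin (Diagram.id [false, true]))
  | reidemeister_two_LR (s : Bool) : SkeinRel q r δ
      (lin ((crossingLR s).comp (crossingRL (!s))) - lin (Diagram.id [true, false]))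
  | reidemeister_three (s : Bool) : SkeinRel q r δ (lin (braidLeft s) - lin (braidRight s))
  | circle (b : Bool) : SkeinRel q r δ (lin (circle b) - δ • lin (Diagram.id []))

/-- The span of the relations, each applied inside of all larger diagrams. -/
def skeinSubmodule (q r δ : ℂ) (w : Word) : Submodule ℂ (HDiagram [] w →₀ ℂ) :=
  Submodule.span ℂ { x | ∃ (a b l t : Word) (pre : HDiagram [] (l ++ (a ++ t)))
    (post : HDiagram (l ++ (b ++ t)) w) (y : HDiagram a b →₀ ℂ),
    SkeinRel q r δ y ∧ x = y.mapDomain fun A => A.insert l t pre post }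

/-- The space `P_{n,±}` of the HOMFLY-PT planar algebra: linear combinations of HOMFLY-PT diagrams
with `2n` boundary points of alternating orientation, modulo the skein relations. -/
abbrev HSpace (q r δ : ℂ) (c : Color) : Type :=
  (HDiagram [] c.word →₀ ℂ) ⧸ skeinSubmodule q r δ c.word

/-- The class of a diagram. -/
def HSpace.mk (q r δ : ℂ) {c : Color} (D : HDiagram [] c.word) : HSpace q r δ c :=
  Submodule.Quotient.mk (lin D)

end

/-! ## The HOMFLY-PT planar algebra -/

section Subst

variable {ι κ : Type}

theorem Layer.subst_addLeft {bd : ι → Word} {bd' : κ → Word} (D : ∀ i, Diagram bd' [] (bd i))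
    (l : Word) (L : Layer ι) :
    (L.addLeft l).subst D = (L.subst D).map (Layer.addLeft l) := by
  rcases L with ⟨a, b | b | i, r⟩
  · rfl
  · rfl
  · simp [Layer.subst, Layer.addLeft, Diagram.addLeft, Function.comp_def]

theorem Layer.subst_addRight {bd : ι → Word} {bd' : κ → Word} (D : ∀ i, Diagram bd' [] (bd i))
    (l : Word) (L : Layer ι) :
    (L.addRight l).subst D = (L.subst D).map (Layer.addRight l) := by
  rcases L with ⟨a, b | b | i, r⟩
  · rfl
  · rfl
  · simp [Layer.subst, Layer.addLeft, Layer.addRight, Diagram.addLeft, Diagram.addRight,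
      Function.comp_def]

namespace Diagram

variable {bd : ι → Word} {bd' : κ → Word}

theorem subst_addLeft {a b : Word} (l : Word) (T : Diagram bd a b)
    (D : ∀ i, Diagram bd' [] (bd i)) : (T.addLeft l).subst D = (T.subst D).addLeft l := by
  ext1
  simp only [subst, addLeft, List.map_flatMap, List.flatMap_map]
  congr 1; funext L; exact L.subst_addLeft D l

theorem subst_addRight {a b : Word} (l : Word) (T : Diagram bd a b)
    (D : ∀ i, Diagram bd' [] (bd i)) : (T.addRight l).subst D = (T.subst D).addRight l := by
  ext1
  simp only [subst, addRight, List.map_flatMap, List.flatMap_map]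
  congr 1; funext L; exact L.subst_addRight D l

theorem subst_comp {a b c : Word} (T : Diagram bd a b) (T' : Diagram bd b c)
    (D : ∀ i, Diagram bd' [] (bd i)) : (T.comp T').subst D = (T.subst D).comp (T'.subst D) := by
  ext1; simp [subst, comp]

theorem subst_cast {a b a' b' : Word} (T : Diagram bd a b) (ha : a = a') (hb : b = b')
    (D : ∀ i, Diagram bd' [] (bd i)) : (T.cast ha hb).subst D = (T.subst D).cast ha hb := rfl

theorem subst_insert {a b u v : Word} (A : Diagram bd a b) (l r : Word)
    (pre : Diagram bd u (l ++ (a ++ r))) (post : Diagram bd (l ++ (b ++ r)) v)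
    (D : ∀ i, Diagram bd' [] (bd i)) :
    (A.insert l r pre post).subst D = (A.subst D).insert l r (pre.subst D) (post.subst D) := by
  simp only [insert, subst_comp, subst_addLeft, subst_addRight]

theorem subst_cups (D : ∀ i, Diagram bd' [] (bd i)) : ∀ w : Word, (cups w).subst D = cups w
  | [] => rfl
  | b :: w => by
    simp only [cups, subst_comp, subst_cups D w, subst_cast, subst_addLeft, subst_addRight]
    rfl

theorem subst_caps (D : ∀ i, Diagram bd' [] (bd i)) : ∀ w : Word, (caps w).subst D = caps w
  | [] => rfl
  | b :: w => by
    simp only [caps, subst_comp, subst_caps D w, subst_cast, subst_addLeft, subst_addRight]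
    rfl

theorem subst_rotate {w : Word} (T : Diagram bd [] w) (D : ∀ i, Diagram bd' [] (bd i)) :
    T.rotate.subst D = (T.subst D).rotate := by
  simp only [rotate, subst_comp, subst_cast, subst_addLeft, subst_addRight, subst_cups,
    subst_caps]

end Diagram

theorem LocalIsotopy.subst {bd : ι → Word} {bd' : κ → Word} {a b : Word} {A B : Diagram bd a b}
    (h : LocalIsotopy A B) (D : ∀ i, Diagram bd' [] (bd i)) :
    LocalIsotopy (A.subst D) (B.subst D) := by
  cases h with
  | exchange E F =>
    simp only [Diagram.subst_comp, Diagram.subst_addLeft, Diagram.subst_addRight]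
    exact .exchange _ _
  | zigzagLeft b => exact .zigzagLeft b
  | zigzagRight b => exact .zigzagRight b
  | rotate => rw [Diagram.subst_rotate]; exact .rotate _

theorem Isotopic.subst {bd : ι → Word} {bd' : κ → Word} {a b : Word} {T T' : Diagram bd a b}
    (h : Isotopic T T') (D : ∀ i, Diagram bd' [] (bd i)) :
    Isotopic (T.subst D) (T'.subst D) := by
  induction h with
  | rel x y h =>
    obtain ⟨a, b, l, r, pre, post, A, B, hAB, rfl, rfl⟩ := h
    rw [Diagram.subst_insert, Diagram.subst_insert]
    exact .rel _ _ ⟨a, b, l, r, _, _, _, _, hAB.subst D, rfl, rfl⟩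
  | refl x => exact .refl _
  | symm x y _ ih => exact .symm _ _ ih
  | trans x y z _ _ h₁ h₂ => exact .trans _ _ _ h₁ h₂

theorem Diagram.insert_insert {bd : ι → Word} {a b a' b' u v : Word} (A : Diagram bd a b)
    (l r : Word) (pre : Diagram bd a' (l ++ (a ++ r))) (post : Diagram bd (l ++ (b ++ r)) b')
    (l' r' : Word) (pre' : Diagram bd u (l' ++ (a' ++ r')))
    (post' : Diagram bd (l' ++ (b' ++ r')) v) :
    (A.insert l r pre post).insert l' r' pre' post' = A.insert (l' ++ l) (r ++ r')
      ((pre'.comp ((pre.addRight r').addLeft l')).cast rfl (by simp))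
      ((((post.addRight r').addLeft l').comp post').cast (by simp) rfl) := by
  ext1
  simp only [insert, comp, addLeft, addRight, Diagram.cast, List.map_append, List.map_map,
    List.append_assoc]
  congr 3
  refine List.map_congr_left fun L _ => ?_
  simp [Layer.addLeft, Layer.addRight]

/-- If the label `i` occurs only once, then the other boxes can be filled first. -/
theorem Diagram.exists_insert [DecidableEq ι] {bd : ι → Word} {bd' : κ → Word} {a b : Word}
    (T : Diagram bd a b) (hT : T.labels.Nodup) (i : ι) (hi : i ∈ T.labels)
    (D : ∀ i, Diagram bd' [] (bd i)) :
    ∃ (l r : Word) (pre : Diagram bd' a (l ++ ([] ++ r)))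
      (post : Diagram bd' (l ++ (bd i ++ r)) b),
      ∀ A, T.subst (Function.update D i A) = A.insert l r pre post := by
  have key : ∀ (Ls : List (Layer ι)) (a : Word) (h : IsPath bd a Ls b),
      (Ls.filterMap Layer.label?).Nodup → i ∈ Ls.filterMap Layer.label? →
      ∃ (l r : Word) (pre : Diagram bd' a (l ++ ([] ++ r)))
      (post : Diagram bd' (l ++ (bd i ++ r)) b),
      ∀ A, (⟨Ls, h⟩ : Diagram bd a b).subst (Function.update D i A) = A.insert l r pre post := by
    intro Ls
    induction Ls with
    | nil => intro a h _ hi; simp at hi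
    | cons L Ls ih =>
      intro a h hnd hi
      have hL := h.1
      have hrest : i ∉ Ls.filterMap Layer.label? →
          ∀ A, Ls.flatMap (Layer.subst (Function.update D i A)) = Ls.flatMap (Layer.subst D) := by
        intro hni A
        refine List.flatMap_congr fun K hK => ?_
        rcases K with ⟨l, b | b | j, r⟩
        · rfl
        · rfl
        · have hj : j ≠ i := by
            rintro rfl
            exact hni (List.mem_filterMap.2 ⟨_, hK, rfl⟩)
          simp [Layer.subst, hj]
      by_cases hLi : L.piece = .box i
      · rcases L with ⟨l, p, r⟩
        obtain rfl : p = .box i := hLi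
        have hnd' : (i :: Ls.filterMap Layer.label?).Nodup := hnd
        have hni := (List.nodup_cons.1 hnd').1
        refine ⟨l, r, (Diagram.id _).cast hL.symm rfl,
          (⟨Ls, h.2⟩ : Diagram bd _ b).subst D, fun A => ?_⟩
        ext1
        simp only [Diagram.subst, Diagram.insert, Diagram.comp, Diagram.cast, Diagram.id,
          List.flatMap_cons, List.nil_append, hrest hni A]
        simp [Layer.subst]
      · have hLs : i ∈ Ls.filterMap Layer.label? ∧ (Ls.filterMap Layer.label?).Nodup := by
          rcases L with ⟨l, b | b | j, r⟩
          · exact ⟨hi, hnd⟩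
          · exact ⟨hi, hnd⟩
          · have hi' : i ∈ j :: Ls.filterMap Layer.label? := hi
            have hnd' : (j :: Ls.filterMap Layer.label?).Nodup := hnd
            refine ⟨(List.mem_cons.1 hi').resolve_left ?_, hnd'.of_cons⟩
            rintro rfl
            exact hLi rfl
        obtain ⟨l, r, pre, post, H⟩ := ih _ h.2 hLs.2 hLs.1
        refine ⟨l, r, (⟨L.subst D, hL ▸ L.isPath_subst D⟩ : Diagram bd' a _).comp pre, post,
          fun A => ?_⟩
        have H' := congrArg Diagram.layers (H A)
        have hLD : L.subst (Function.update D i A) = L.subst D := by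
          rcases L with ⟨l, b | b | j, r⟩
          · rfl
          · rfl
          · have hj : j ≠ i := by
              rintro rfl
              exact hLi rfl
            simp [Layer.subst, hj]
        ext1
        simp only [Diagram.subst, Diagram.insert, Diagram.comp] at H' ⊢
        rw [List.flatMap_cons, H', hLD, List.append_assoc]
  exact key T.layers a T.isPath hT hi

theorem Diagram.box_subst {bd : ι → Word} {bd' : κ → Word} (i : ι)
    (D : ∀ i, Diagram bd' [] (bd i)) : (Diagram.box (bd := bd) i).subst D = D i := by
  ext1
  simp only [Diagram.box, Diagram.subst, Layer.subst, Diagram.addLeft, Diagram.addRight,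
    List.flatMap_cons, List.flatMap_nil, List.append_nil, List.map_map]
  conv_rhs => rw [← List.map_id (D i).layers]
  refine List.map_congr_left fun L _ => ?_
  simp [Layer.addLeft, Layer.addRight]

theorem Diagram.relabel_subst {bd : κ → Word} {μ : Type} {bd' : μ → Word} (f : ι → κ) {a b : Word}
    (T : Diagram (fun i => bd (f i)) a b) (D : ∀ j, Diagram bd' [] (bd j)) :
    (T.relabel f).subst D = T.subst fun i => D (f i) := by
  ext1
  simp only [Diagram.relabel, Diagram.subst, List.flatMap_map]
  refine List.flatMap_congr fun L _ => ?_
  rcases L with ⟨l, b | b | i, r⟩ <;> rfl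

theorem Diagram.subst_subst {μ : Type} {bd : ι → Word} {bd' : κ → Word} {bd'' : μ → Word}
    {a b : Word} (T : Diagram bd a b) (S : ∀ i, Diagram bd' [] (bd i))
    (D : ∀ j, Diagram bd'' [] (bd' j)) :
    (T.subst S).subst D = T.subst fun i => (S i).subst D := by
  ext1
  simp only [Diagram.subst, List.flatMap_assoc]
  refine List.flatMap_congr fun L _ => ?_
  rcases L with ⟨l, b | b | i, r⟩
  · simp [Layer.subst]
  · simp [Layer.subst]
  · have := congrArg Diagram.layers (((S i).addRight r).subst_addLeft l D)
    rw [Diagram.subst_addRight] at this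
    exact this

end Subst

noncomputable section

theorem liftQuotient_aux {ι : Type} [Finite ι] {M : ι → Type} [∀ i, AddCommGroup (M i)]
    [∀ i, Module ℂ (M i)] {P : Type} [AddCommGroup P] [Module ℂ P] (N : ∀ i, Submodule ℂ (M i))
    (G : MultilinearMap ℂ M P)
    (h : ∀ [DecidableEq ι] (v : ∀ i, M i) (i : ι), ∀ x ∈ N i, G (Function.update v i x) = 0)
    (v v' : ∀ i, M i) (hv : ∀ i, (Submodule.Quotient.mk (v i) : M i ⧸ N i) =
      Submodule.Quotient.mk (v' i)) : G v = G v' := by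
  classical
  have step : ∀ s : Finset ι, G (s.piecewise v' v) = G v := by
    intro s
    induction s using Finset.induction_on with
    | empty => simp
    | insert i s hi ih =>
      rw [Finset.piecewise_insert, ← ih]
      have h1 : s.piecewise v' v = Function.update (s.piecewise v' v) i (v' i + (v i - v' i)) := by
        rw [add_sub_cancel, eq_comm, Function.update_eq_self_iff,
          Finset.piecewise_eq_of_notMem _ _ _ hi]
      conv_rhs => rw [h1, G.map_update_add,
        h _ i _ ((Submodule.Quotient.eq (N i)).1 (hv i)), add_zero]
  cases nonempty_fintype ι
  rw [← step Finset.univ, Finset.piecewise_univ]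

/-- A multilinear map that vanishes as soon as one argument lies in `N i` descends to the
quotients. -/
def liftQuotient {ι : Type} [Finite ι] {M : ι → Type} [∀ i, AddCommGroup (M i)]
    [∀ i, Module ℂ (M i)] {P : Type} [AddCommGroup P] [Module ℂ P] (N : ∀ i, Submodule ℂ (M i))
    (G : MultilinearMap ℂ M P)
    (h : ∀ [DecidableEq ι] (v : ∀ i, M i) (i : ι), ∀ x ∈ N i, G (Function.update v i x) = 0) :
    MultilinearMap ℂ (fun i => M i ⧸ N i) P :=
  { toFun := fun v => G fun i => (v i).out
    map_update_add' := by
      intro _ v i x y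
      have e : ∀ z : M i ⧸ N i, G (fun j => (Function.update v i z j).out) =
          G (Function.update (fun j => (v j).out) i z.out) := by
        intro z
        congr 1; funext j
        by_cases hj : j = i
        · subst hj; simp
        · simp [hj]
      rw [e, e, e, ← G.map_update_add]
      refine liftQuotient_aux N G h _ _ fun j => ?_
      by_cases hj : j = i
      · subst hj
        simp [Submodule.Quotient.mk_out]
      · simp [hj]
    map_update_smul' := by
      intro _ v i t x
      have e : ∀ z : M i ⧸ N i, G (fun j => (Function.update v i z j).out) =
          G (Function.update (fun j => (v j).out) i z.out) := by
        intro z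
        congr 1; funext j
        by_cases hj : j = i
        · subst hj; simp
        · simp [hj]
      rw [e, e, ← G.map_update_smul]
      refine liftQuotient_aux N G h _ _ fun j => ?_
      by_cases hj : j = i
      · subst hj
        simp [Submodule.Quotient.mk_out]
      · simp [hj] }

end

noncomputable section

/-- The class of a diagram whose boundary word is arbitrary. -/
def skeinClass (q r δ : ℂ) {w : Word} (D : HDiagram [] w) :
    (HDiagram [] w →₀ ℂ) ⧸ skeinSubmodule q r δ w := Submodule.Quotient.mk (lin D)

theorem Isotopic.skeinClass_eq (q r δ : ℂ) {w : Word} {D D' : HDiagram [] w}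
    (h : Isotopic D D') : skeinClass q r δ D = skeinClass q r δ D' := by
  induction h with
  | rel x y h =>
    obtain ⟨a, b, l, t, pre, post, A, B, hAB, rfl, rfl⟩ := h
    refine (Submodule.Quotient.eq _).2 (Submodule.subset_span ?_)
    refine ⟨a, b, l, t, pre, post, _, .isotopy hAB, ?_⟩
    simp only [lin, sub_eq_add_neg, Finsupp.mapDomain_add, ← Finsupp.single_neg,
      Finsupp.mapDomain_single]
  | refl x => rfl
  | symm x y _ ih => exact ih.symm
  | trans x y z _ _ h₁ h₂ => exact h₁.trans h₂

theorem mapDomain_insert_mem (q r δ : ℂ) {v w : Word} (l t : Word)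
    (pre : HDiagram [] (l ++ ([] ++ t))) (post : HDiagram (l ++ (v ++ t)) w)
    {x : HDiagram [] v →₀ ℂ} (hx : x ∈ skeinSubmodule q r δ v) :
    x.mapDomain (fun A => A.insert l t pre post) ∈ skeinSubmodule q r δ w := by
  induction hx using Submodule.span_induction with
  | mem x hx =>
    obtain ⟨a, b, l', t', pre', post', y, hy, rfl⟩ := hx
    refine Submodule.subset_span ⟨a, b, l ++ l', t' ++ t,
      (pre.comp ((pre'.addRight t).addLeft l)).cast rfl (by simp),
      (((post'.addRight t).addLeft l).comp post).cast (by simp) rfl, y, hy, ?_⟩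
    rw [← Finsupp.mapDomain_comp]
    congr 1; funext A
    exact Diagram.insert_insert A l' t' pre' post' l t pre post
  | zero => simp
  | add x y _ _ hx hy => rw [Finsupp.mapDomain_add]; exact Submodule.add_mem _ hx hy
  | smul c x _ hx => rw [Finsupp.mapDomain_smul]; exact Submodule.smul_mem _ c hx

section Act

variable (q r δ : ℂ) {ι : Type} [Finite ι] {c : ι → Color} {o : Color}

open Classical in
/-- The multilinear extension of the substitution of diagrams in the input discs of a tangle. -/
def actFree (T : PlanarTangle c o) :
    MultilinearMap ℂ (fun i => HDiagram [] (c i).word →₀ ℂ) (HSpace q r δ o) :=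
  letI := Fintype.ofFinite ι
  ((skeinSubmodule q r δ o.word).mkQ ∘ₗ
    Finsupp.lmapDomain ℂ ℂ (fun D => T.diagram.subst D) ∘ₗ
    (PiTensorProduct.ofFinsuppEquiv' (R := ℂ)
      (κ := fun i => HDiagram [] (c i).word)).toLinearMap).compMultilinearMap
    (PiTensorProduct.tprod ℂ)

theorem actFree_lin (T : PlanarTangle c o) (D : ∀ i, HDiagram [] (c i).word) :
    actFree q r δ T (fun i => lin (D i)) = HSpace.mk q r δ (T.diagram.subst D) := by
  classical
  simp [actFree, lin, HSpace.mk]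

theorem actFree_update [DecidableEq ι] (T : PlanarTangle c o)
    (D : ∀ i, HDiagram [] (c i).word) (i : ι) (x : HDiagram [] (c i).word →₀ ℂ) :
    actFree q r δ T (Function.update (fun j => lin (D j)) i x) = (skeinSubmodule q r δ o.word).mkQ
      (x.mapDomain fun A => T.diagram.subst (Function.update D i A)) := by
  induction x using Finsupp.induction_linear with
  | zero => simp
  | add x y hx hy => rw [MultilinearMap.map_update_add, hx, hy, Finsupp.mapDomain_add, map_add]
  | single A z =>
    have h1 : (Finsupp.single A z : HDiagram [] (c i).word →₀ ℂ) = z • lin A := by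
      simp [lin]
    have h2 : Function.update (fun j => lin (D j)) i (lin A) =
        fun j => lin (Function.update D i A j) := by
      funext j
      by_cases hj : j = i
      · subst hj; simp
      · simp [hj]
    rw [h1, MultilinearMap.map_update_smul, h2, actFree_lin, Finsupp.mapDomain_smul, map_smul,
      lin, Finsupp.mapDomain_single]
    rfl

theorem actFree_eq_zero [DecidableEq ι] (T : PlanarTangle c o)
    (v : ∀ i, HDiagram [] (c i).word →₀ ℂ) (i : ι) (x : HDiagram [] (c i).word →₀ ℂ)
    (hx : x ∈ skeinSubmodule q r δ (c i).word) :
    actFree q r δ T (Function.update v i x) = 0 := by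
  let L : ∀ j, (HDiagram [] (c j).word →₀ ℂ) →ₗ[ℂ] (HDiagram [] (c j).word →₀ ℂ) :=
    Function.update (fun _ => LinearMap.id) i
      (LinearMap.toSpanSingleton ℂ _ x ∘ₗ Finsupp.linearCombination ℂ fun _ => (1 : ℂ))
  have hL : ∀ u : ∀ j, HDiagram [] (c j).word →₀ ℂ, (fun j => L j (u j)) =
      Function.update u i ((Finsupp.linearCombination ℂ (fun _ => (1 : ℂ)) (u i)) • x) := by
    intro u; funext j
    by_cases hj : j = i
    · subst hj; simp [L]
    · simp [L, hj]
  have hH : (actFree q r δ T).compLinearMap L = 0 := by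
    refine Module.Basis.ext_multilinear
      (fun j => Finsupp.basisSingleOne (R := ℂ) (ι := HDiagram [] (c j).word)) fun D => ?_
    rw [MultilinearMap.compLinearMap_apply, hL]
    have : (fun j => Finsupp.basisSingleOne (R := ℂ) (D j)) = fun j => lin (D j) := by
      funext j; simp [lin]
    rw [this, MultilinearMap.map_update_smul, actFree_update]
    obtain ⟨l, t, pre, post, H⟩ :=
      T.diagram.exists_insert T.labels_nodup i (T.mem_labels i) D
    simp only [H]
    rw [_root_.zero_apply, Submodule.mkQ_apply,
      (Submodule.Quotient.mk_eq_zero _).2 (mapDomain_insert_mem q r δ l t pre post hx), smul_zero]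
  rcases isEmpty_or_nonempty (HDiagram [] (c i).word) with he | ⟨⟨D₀⟩⟩
  · rw [Subsingleton.elim x 0, MultilinearMap.map_update_zero]
  · have := DFunLike.congr_fun hH (Function.update v i (lin D₀))
    rw [MultilinearMap.compLinearMap_apply, hL] at this
    simpa [lin] using this

/-- The action of a tangle on the HOMFLY-PT spaces: glue HOMFLY-PT diagrams into the input discs. -/
def act (T : PlanarTangle c o) :
    MultilinearMap ℂ (fun i => HSpace q r δ (c i)) (HSpace q r δ o) :=
  liftQuotient (fun i => skeinSubmodule q r δ (c i).word) (actFree q r δ T)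
    fun v i x hx => actFree_eq_zero q r δ T v i x hx

theorem liftQuotient_mk {ι : Type} [Finite ι] {M : ι → Type} [∀ i, AddCommGroup (M i)]
    [∀ i, Module ℂ (M i)] {P : Type} [AddCommGroup P] [Module ℂ P] (N : ∀ i, Submodule ℂ (M i))
    (G : MultilinearMap ℂ M P)
    (h : ∀ [DecidableEq ι] (v : ∀ i, M i) (i : ι), ∀ x ∈ N i, G (Function.update v i x) = 0)
    (v : ∀ i, M i) :
    liftQuotient N G h (fun i => Submodule.Quotient.mk (v i)) = G v :=
  liftQuotient_aux N G h _ _ fun _ => Submodule.Quotient.mk_out _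

theorem act_mk (T : PlanarTangle c o) (D : ∀ i, HDiagram [] (c i).word) :
    act q r δ T (fun i => HSpace.mk q r δ (D i)) = HSpace.mk q r δ (T.diagram.subst D) :=
  (liftQuotient_mk _ _ _ fun i => lin (D i)).trans (actFree_lin q r δ T D)

/-- Multilinear maps on the HOMFLY-PT spaces are determined by their values on diagrams. -/
theorem HSpace.ext_multilinear {P : Type} [AddCommGroup P] [Module ℂ P]
    {f g : MultilinearMap ℂ (fun i => HSpace q r δ (c i)) P}
    (h : ∀ D : ∀ i, HDiagram [] (c i).word,
      f (fun i => HSpace.mk q r δ (D i)) = g (fun i => HSpace.mk q r δ (D i))) : f = g := by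
  refine (MultilinearMap.compLinearMap_injective
    (fun i => (skeinSubmodule q r δ (c i).word).mkQ) fun i => Submodule.mkQ_surjective _) ?_
  refine Module.Basis.ext_multilinear
    (fun j => Finsupp.basisSingleOne (R := ℂ) (ι := HDiagram [] (c j).word)) fun D => ?_
  simpa [HSpace.mk, lin] using h D


theorem act_relabel {κ : Type} [Finite κ] (e : ι ≃ κ) {c : κ → Color}
    (T : PlanarTangle (fun i => c (e i)) o) (v : ∀ j, HSpace q r δ (c j)) :
    act q r δ (T.relabel e) v = act q r δ T fun i => v (e i) := by
  have key : act q r δ (T.relabel e) =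
      (MultilinearMap.domDomCongrLinearEquiv' ℂ ℂ (fun j => HSpace q r δ (c j)) (HSpace q r δ o)
        e.symm).symm (act q r δ T) :=
    HSpace.ext_multilinear q r δ fun D =>
      (act_mk q r δ (T.relabel e) D).trans
        ((congrArg (HSpace.mk q r δ) (Diagram.relabel_subst (bd := fun j => (c j).word) e
          T.diagram D)).trans (act_mk q r δ T fun i => D (e i)).symm)
  exact DFunLike.congr_fun key v

theorem act_id (o : Color) (v : Unit → HSpace q r δ o) :
    act q r δ (PlanarTangle.id o) v = v () := by
  have key : act q r δ (PlanarTangle.id o) =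
      MultilinearMap.ofSubsingleton ℂ _ _ () LinearMap.id :=
    HSpace.ext_multilinear q r δ fun D => (act_mk q r δ (PlanarTangle.id o) D).trans
      (congrArg (HSpace.mk q r δ) (Diagram.box_subst () D))
  exact DFunLike.congr_fun key v

theorem act_comp {κ : ι → Type} [∀ i, Finite (κ i)] {d : ∀ i, κ i → Color} (T : PlanarTangle c o)
    (S : ∀ i, PlanarTangle (d i) (c i)) (v : ∀ x : Σ i, κ i, HSpace q r δ (d x.1 x.2)) :
    act q r δ (T.comp S) v = act q r δ T fun i => act q r δ (S i) fun j => v ⟨i, j⟩ := by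
  have key : act q r δ (T.comp S) =
      (act q r δ T).compMultilinearMap (N := fun i j => HSpace q r δ (d i j))
        (fun i => act q r δ (S i)) := by
    refine HSpace.ext_multilinear q r δ fun D => ?_
    have h : ∀ i, act q r δ (S i) (fun j => HSpace.mk q r δ (D ⟨i, j⟩)) =
        HSpace.mk q r δ ((S i).diagram.subst fun j => D ⟨i, j⟩) :=
      fun i => act_mk q r δ (S i) fun j => D ⟨i, j⟩
    have h' : (T.comp S).diagram.subst D =
        T.diagram.subst fun i => (S i).diagram.subst fun j => D ⟨i, j⟩ :=
      (Diagram.subst_subst T.diagram _ D).trans (congrArg T.diagram.subst (funext fun i =>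
        Diagram.relabel_subst (bd := fun x : Σ i, κ i => (d x.1 x.2).word) (Sigma.mk i)
          (S i).diagram D))
    refine (act_mk q r δ (T.comp S) D).trans ?_
    refine (congrArg (HSpace.mk q r δ) h').trans ?_
    refine (act_mk q r δ T _).symm.trans ?_
    exact congrArg (act q r δ T) (funext fun i => (h i).symm)
  exact DFunLike.congr_fun key v

theorem act_isotopy (T T' : PlanarTangle c o) (h : Isotopic T.diagram T'.diagram) :
    act q r δ T = act q r δ T' :=
  HSpace.ext_multilinear q r δ fun D => by
    rw [act_mk, act_mk]
    exact (h.subst D).skeinClass_eq q r δ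

end Act

/-- The HOMFLY-PT planar algebra with parameters `q`, `r` and circle parameter `δ`. -/
def homflyPT (q r δ : ℂ) : PlanarAlgebra where
  space c := HSpace q r δ c
  act T := act q r δ T
  act_isotopy T T' h := Homfly.act_isotopy q r δ T T' h
  act_relabel e _ _ T v := Homfly.act_relabel q r δ e T v
  act_id o v := Homfly.act_id q r δ o v
  act_comp T S v := Homfly.act_comp q r δ T S v

/-- The class of a diagram as an element of the HOMFLY-PT planar algebra. -/
def diagramClass (q r δ : ℂ) {c : Color} (D : HDiagram [] c.word) : (homflyPT q r δ).space c :=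
  HSpace.mk q r δ D

end

end Homfly

/-! All three isomorphisms are instances of one construction. Choose a sign `ε` with `ε * ε = 1` and
an involution `f` of the two crossing signs that commutes with negation, so `f` either keeps every
sign or flips every sign. The twist applies `f` to all crossings of a diagram `D` and multiplies the
result by `ε ^ c(D)`, where `c(D)` is the number of crossings. It is an involution on formal linear
combinations, because `f` does not change `c(D)`.

The twist descends to the quotients if it carries each local relation for `(q, r)` to a multiple of
a local relation for `(q', r')` (`twistsRelations`). Isotopies and the third Reidemeister move have
equally many crossings on both sides. The second Reidemeister moves cost `ε ^ 2 = 1`, and a circle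
has no crossings, so `δ` stays the same. Only two relations impose conditions: the Hecke relation
requires `q' - q'⁻¹ = ±ε * (q - q⁻¹)`, with the minus sign exactly if `f` flips the signs, and the
kinks require that the factor of the kink with sign `f s` for `r'` is `ε` times the factor of the
kink with sign `s` for `r`. The parameter changes `(-q⁻¹, r)`, `(-q, -r)` and `(q⁻¹, r⁻¹)` meet
these conditions with `(ε, f) = (1, id)`, `(-1, id)` and `(1, not)`, and the same pair serves for
the inverse change.

Passing from local relations to relations inside larger diagrams is harmless, since the crossings
outside contribute only a common scalar (`twist_mapDomain_insert`). The twist commutes with tangles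
because each input disc occurs exactly once in a tangle, so the crossing number of a glued diagram
is the sum over the inputs (`PlanarTangle.crossings_subst`), while `f` acts on each input separately
(`Diagram.subst_relabel`). -/

namespace Homfly

/-! ### Change of labels commutes with the operations on diagrams -/

section Relabel

variable {ι κ : Type} {bd : κ → Word} (f : ι → κ)

theorem Diagram.relabel_comp {a b c : Word} (D : Diagram (fun i => bd (f i)) a b)
    (E : Diagram (fun i => bd (f i)) b c) :
    (D.comp E).relabel f = (D.relabel f).comp (E.relabel f) := by
  ext1; simp [Diagram.relabel, Diagram.comp]

theorem Diagram.relabel_addLeft {a b : Word} (l : Word) (D : Diagram (fun i => bd (f i)) a b) :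
    (D.addLeft l).relabel f = (D.relabel f).addLeft l := by
  ext1
  simp only [Diagram.relabel, Diagram.addLeft, List.map_map]
  rfl

theorem Diagram.relabel_addRight {a b : Word} (l : Word) (D : Diagram (fun i => bd (f i)) a b) :
    (D.addRight l).relabel f = (D.relabel f).addRight l := by
  ext1
  simp only [Diagram.relabel, Diagram.addRight, List.map_map]
  rfl

theorem Diagram.relabel_cast {a b a' b' : Word} (D : Diagram (fun i => bd (f i)) a b)
    (ha : a = a') (hb : b = b') : (D.cast ha hb).relabel f = (D.relabel f).cast ha hb := rfl

theorem Diagram.relabel_insert {a b u v : Word} (A : Diagram (fun i => bd (f i)) a b) (l r : Word)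
    (pre : Diagram (fun i => bd (f i)) u (l ++ (a ++ r)))
    (post : Diagram (fun i => bd (f i)) (l ++ (b ++ r)) v) :
    (A.insert l r pre post).relabel f =
      (A.relabel f).insert l r (pre.relabel f) (post.relabel f) := by
  simp only [Diagram.insert, Diagram.relabel_comp, Diagram.relabel_addLeft,
    Diagram.relabel_addRight]

theorem Diagram.relabel_cups :
    ∀ w : Word, (Diagram.cups (bd := fun i => bd (f i)) w).relabel f = Diagram.cups w
  | [] => rfl
  | b :: w => by
    simp only [Diagram.cups, Diagram.relabel_comp, Diagram.relabel_cups w, Diagram.relabel_cast,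
      Diagram.relabel_addLeft, Diagram.relabel_addRight]
    rfl

theorem Diagram.relabel_caps :
    ∀ w : Word, (Diagram.caps (bd := fun i => bd (f i)) w).relabel f = Diagram.caps w
  | [] => rfl
  | b :: w => by
    simp only [Diagram.caps, Diagram.relabel_comp, Diagram.relabel_caps w, Diagram.relabel_cast,
      Diagram.relabel_addLeft, Diagram.relabel_addRight]
    rfl

/-- The strings that turn the boundary around consist of minima and maxima only, so they carry no
labels to be changed. -/
theorem Diagram.relabel_rotate {w : Word} (D : Diagram (fun i => bd (f i)) [] w) :
    D.rotate.relabel f = (D.relabel f).rotate := by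
  simp only [Diagram.rotate, Diagram.relabel_comp, Diagram.relabel_cast, Diagram.relabel_addLeft,
    Diagram.relabel_addRight, Diagram.relabel_cups, Diagram.relabel_caps]

theorem LocalIsotopy.relabel {a b : Word} {A B : Diagram (fun i => bd (f i)) a b}
    (h : LocalIsotopy A B) : LocalIsotopy (A.relabel f) (B.relabel f) := by
  cases h with
  | exchange E F =>
    simp only [Diagram.relabel_comp, Diagram.relabel_addLeft, Diagram.relabel_addRight]
    exact .exchange _ _
  | zigzagLeft b => exact .zigzagLeft b
  | zigzagRight b => exact .zigzagRight b
  | rotate => rw [Diagram.relabel_rotate]; exact .rotate _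

/-- Every box of `T` is filled, so all labels of the result come from the inserted diagrams. For
crossings this makes sign changes compatible with the action of a tangle. -/
theorem Diagram.subst_relabel {μ : Type} {bd' : μ → Word} {a b : Word} (T : Diagram bd' a b)
    (D : ∀ i, Diagram (fun i => bd (f i)) [] (bd' i)) :
    (T.subst D).relabel f = T.subst fun i => (D i).relabel f := by
  ext1
  simp only [Diagram.relabel, Diagram.subst, List.map_flatMap]
  refine List.flatMap_congr fun L _ => ?_
  rcases L with ⟨l, b | b | i, r⟩
  · rfl
  · rfl
  · have := congrArg Diagram.layers (Diagram.relabel_addLeft f l ((D i).addRight r))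
    rw [Diagram.relabel_addRight] at this
    exact this

end Relabel

/-! ### Labels under gluing and isotopy -/

section Labels

variable {ι : Type} {bd : ι → Word}

theorem Diagram.labels_comp {a b c : Word} (D : Diagram bd a b) (E : Diagram bd b c) :
    (D.comp E).labels = D.labels ++ E.labels := by
  simp only [Diagram.labels_eq, Diagram.comp, List.filterMap_append]

theorem Diagram.labels_cast {a b a' b' : Word} (D : Diagram bd a b) (ha : a = a') (hb : b = b') :
    (D.cast ha hb).labels = D.labels := rfl

theorem Diagram.labels_cups : ∀ w : Word, (Diagram.cups (bd := bd) w).labels = []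
  | [] => rfl
  | b :: w => by
    simp only [Diagram.cups, Diagram.labels_comp, Diagram.labels_cups w, Diagram.labels_cast,
      Diagram.labels_addLeft, Diagram.labels_addRight]
    rfl

theorem Diagram.labels_caps : ∀ w : Word, (Diagram.caps (bd := bd) w).labels = []
  | [] => rfl
  | b :: w => by
    simp only [Diagram.caps, Diagram.labels_comp, Diagram.labels_caps w, Diagram.labels_cast,
      Diagram.labels_addLeft, Diagram.labels_addRight]
    rfl

theorem Diagram.labels_rotate {w : Word} (D : Diagram bd [] w) : D.rotate.labels = D.labels := by
  simp only [Diagram.rotate, Diagram.labels_comp, Diagram.labels_cast, Diagram.labels_addLeft,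
    Diagram.labels_addRight, Diagram.labels_cups, Diagram.labels_caps, List.nil_append,
    List.append_nil]

theorem Diagram.labels_insert {a b u v : Word} (A : Diagram bd a b) (l r : Word)
    (pre : Diagram bd u (l ++ (a ++ r))) (post : Diagram bd (l ++ (b ++ r)) v) :
    (A.insert l r pre post).labels = pre.labels ++ (A.labels ++ post.labels) := by
  simp only [Diagram.insert, Diagram.labels_comp, Diagram.labels_addLeft,
    Diagram.labels_addRight]

/-- The labels of isotopic diagrams agree up to order. -/
theorem LocalIsotopy.labels_perm {a b : Word} {A B : Diagram bd a b} (h : LocalIsotopy A B) :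
    A.labels.Perm B.labels := by
  cases h with
  | exchange E F =>
    simp only [Diagram.labels_comp, Diagram.labels_addLeft, Diagram.labels_addRight]
    -- Exchanging heights concatenates the two lists of labels in the opposite order; this is the
    -- only move that does not preserve the list itself.
    exact List.perm_append_comm
  | zigzagLeft b => exact .refl _
  | zigzagRight b => exact .refl _
  | rotate => rw [Diagram.labels_rotate]

end Labels

/-! ### Sign changes and crossing numbers -/

/-- Change of the signs of the crossings. -/
def HDiagram.mapSigns (f : Bool → Bool) {a b : Word} (D : HDiagram a b) : HDiagram a b :=
  Diagram.relabel (bd := crossingWord) f D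

theorem HDiagram.mapSigns_id {a b : Word} (D : HDiagram a b) : D.mapSigns (fun s => s) = D := by
  refine Diagram.ext ?_
  refine (List.map_congr_left fun L _ => ?_).trans (List.map_id _)
  rcases L with ⟨l, b | b | i, r⟩ <;> rfl

theorem HDiagram.mapSigns_mapSigns {f g : Bool → Bool} (h : ∀ s, g (f s) = s) {a b : Word}
    (D : HDiagram a b) : (D.mapSigns f).mapSigns g = D := by
  refine Diagram.ext ?_
  refine (List.map_map).trans ((List.map_congr_left fun L _ => ?_).trans (List.map_id _))
  rcases L with ⟨l, b | b | i, r⟩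
  · rfl
  · rfl
  · simp [Layer.relabel, h]

theorem HDiagram.crossings_mapSigns (f : Bool → Bool) {a b : Word} (D : HDiagram a b) :
    (D.mapSigns f).crossings = D.crossings :=
  (congrArg List.length (Diagram.labels_relabel (bd := crossingWord) f D)).trans
    (List.length_map f)

theorem HDiagram.crossings_insert {a b u v : Word} (A : HDiagram a b) (l r : Word)
    (pre : HDiagram u (l ++ (a ++ r))) (post : HDiagram (l ++ (b ++ r)) v) :
    HDiagram.crossings (A.insert l r pre post) =
      pre.crossings + (A.crossings + post.crossings) := by
  simp [HDiagram.crossings, Diagram.labels_insert]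

/-- A tangle has no crossings of its own, and its labels list each input disc exactly once, so the
sum over the boxes of the tangle is a sum over the index type. -/
theorem PlanarTangle.crossings_subst {ι : Type} [Fintype ι] {c : ι → Color} {o : Color}
    (T : PlanarTangle c o) (D : ∀ i, HDiagram [] (c i).word) :
    HDiagram.crossings (T.diagram.subst D) = ∑ i, (D i).crossings := by
  classical
  have hT : T.diagram.labels.toFinset = Finset.univ :=
    Finset.eq_univ_iff_forall.2 fun i => List.mem_toFinset.2 (T.mem_labels i)
  rw [← hT, List.sum_toFinset _ T.labels_nodup, HDiagram.crossings, Diagram.labels_subst,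
    List.length_flatMap]
  rfl

/-! ### The twist on formal linear combinations -/

noncomputable section

/-- Change the signs of the crossings, and multiply by `ε` for each crossing. -/
def twist (ε : ℂ) (f : Bool → Bool) (a b : Word) :
    (HDiagram a b →₀ ℂ) →ₗ[ℂ] (HDiagram a b →₀ ℂ) :=
  Finsupp.linearCombination ℂ fun D => ε ^ D.crossings • lin (D.mapSigns f)

theorem twist_lin (ε : ℂ) (f : Bool → Bool) {a b : Word} (D : HDiagram a b) :
    twist ε f a b (lin D) = ε ^ D.crossings • lin (D.mapSigns f) := by
  simp [twist, lin]

/-- Crossing numbers add under insertion, so the surroundings contribute a scalar that does not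
depend on the inserted diagram. It can therefore be pulled out of a whole linear combination. -/
theorem twist_mapDomain_insert (ε : ℂ) (f : Bool → Bool) {a b u v : Word} (l t : Word)
    (pre : HDiagram u (l ++ (a ++ t))) (post : HDiagram (l ++ (b ++ t)) v)
    (y : HDiagram a b →₀ ℂ) :
    twist ε f u v (y.mapDomain fun A => A.insert l t pre post) =
      (ε ^ pre.crossings * ε ^ post.crossings) • (twist ε f a b y).mapDomain fun A =>
        A.insert l t (pre.mapSigns f) (post.mapSigns f) := by
  induction y using Finsupp.induction_linear with
  | zero => simp
  | add x y hx hy => simp only [Finsupp.mapDomain_add, map_add, hx, hy, smul_add]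
  | single A z =>
    have hz : (Finsupp.single A z : HDiagram a b →₀ ℂ) = z • lin A := by simp [lin]
    have hins : HDiagram.mapSigns f (A.insert l t pre post) =
        (A.mapSigns f).insert l t (pre.mapSigns f) (post.mapSigns f) :=
      Diagram.relabel_insert (bd := crossingWord) f A l t pre post
    have hlin : (lin A).mapDomain (fun A => A.insert l t pre post) =
        lin (A.insert l t pre post) := by simp [lin]
    have hlin' : (lin (A.mapSigns f)).mapDomain
        (fun A => A.insert l t (pre.mapSigns f) (post.mapSigns f)) =
        lin ((A.mapSigns f).insert l t (pre.mapSigns f) (post.mapSigns f)) := by simp [lin]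
    rw [hz, Finsupp.mapDomain_smul, map_smul, map_smul, hlin, twist_lin, twist_lin, hins,
      HDiagram.crossings_insert, Finsupp.mapDomain_smul, Finsupp.mapDomain_smul, hlin']
    simp only [smul_smul]
    congr 1
    ring

/-- Both applications see the same number of crossings, so the scalars multiply to a power of `ε *
ε`. -/
theorem twist_twist {ε : ℂ} (hε : ε * ε = 1) {f : Bool → Bool} (hf : ∀ s, f (f s) = s)
    {a b : Word} (x : HDiagram a b →₀ ℂ) : twist ε f a b (twist ε f a b x) = x := by
  have : twist ε f a b ∘ₗ twist ε f a b = LinearMap.id := by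
    refine Finsupp.lhom_ext' fun D => LinearMap.ext_ring ?_
    change twist ε f a b (twist ε f a b (lin D)) = lin D
    rw [twist_lin, map_smul, twist_lin, HDiagram.crossings_mapSigns,
      HDiagram.mapSigns_mapSigns hf, smul_smul, ← mul_pow, hε, one_pow, one_smul]
  exact LinearMap.congr_fun this x

/-! ### Compatibility of the twist with the skein relations -/

/-- The twist maps the relations for the parameters `q, r, δ` to multiples of the relations
for the parameters `q', r', δ`. -/
def TwistsRelations (ε : ℂ) (f : Bool → Bool) (q r q' r' δ : ℂ) : Prop :=
  ∀ (a b : Word) (y : HDiagram a b →₀ ℂ), SkeinRel q r δ y →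
    ∃ (t : ℂ) (y' : HDiagram a b →₀ ℂ), SkeinRel q' r' δ y' ∧ twist ε f a b y = t • y'

theorem twist_mem_skeinSubmodule {ε : ℂ} {f : Bool → Bool} {q r q' r' δ : ℂ}
    (h : TwistsRelations ε f q r q' r' δ) {w : Word} {x : HDiagram [] w →₀ ℂ}
    (hx : x ∈ skeinSubmodule q r δ w) : twist ε f [] w x ∈ skeinSubmodule q' r' δ w := by
  induction hx using Submodule.span_induction with
  | mem x hx =>
    obtain ⟨a, b, l, t, pre, post, y, hy, rfl⟩ := hx
    obtain ⟨z, y', hy', hyy'⟩ := h _ _ y hy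
    rw [twist_mapDomain_insert, hyy', Finsupp.mapDomain_smul]
    -- The outer scalar comes from the crossings of the surroundings, the inner one from the local
    -- relation.
    exact Submodule.smul_mem _ _ (Submodule.smul_mem _ _
      (Submodule.subset_span ⟨a, b, l, t, _, _, y', hy', rfl⟩))
  | zero => simp
  | add x y _ _ hx hy => rw [map_add]; exact Submodule.add_mem _ hx hy
  | smul c x _ hx => rw [map_smul]; exact Submodule.smul_mem _ c hx

theorem twist_lin_sub_smul (ε : ℂ) (f : Bool → Bool) {a b : Word} (D E : HDiagram a b) (t : ℂ) :
    twist ε f a b (lin D - t • lin E) =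
      ε ^ D.crossings • lin (D.mapSigns f) - t • ε ^ E.crossings • lin (E.mapSigns f) := by
  rw [map_sub, map_smul, twist_lin, twist_lin]

theorem twist_lin_sub (ε : ℂ) (f : Bool → Bool) {a b : Word} {D E : HDiagram a b}
    (h : D.crossings = E.crossings) :
    twist ε f a b (lin D - lin E) =
      ε ^ D.crossings • (lin (D.mapSigns f) - lin (E.mapSigns f)) := by
  rw [map_sub, twist_lin, twist_lin, ← h, smul_sub]

/-- The factor of a kink. -/
def kinkFactor (r : ℂ) (s : Bool) : ℂ := cond s r r⁻¹

/-- Treating both signs uniformly lets the twisted relation be named by `f s` without deciding which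
sign that is. -/
theorem SkeinRel.kinkRight (q r δ : ℂ) (s : Bool) :
    SkeinRel q r δ (lin (Homfly.kinkRight s) - kinkFactor r s • lin (Diagram.id [true])) := by
  cases s
  · exact .kinkRight_neg
  · exact .kinkRight_pos

theorem SkeinRel.kinkLeft (q r δ : ℂ) (s : Bool) :
    SkeinRel q r δ (lin (Homfly.kinkLeft s) - kinkFactor r s • lin (Diagram.id [true])) := by
  cases s
  · exact .kinkLeft_neg
  · exact .kinkLeft_pos

/-- A relation between a diagram with one crossing and a diagram without crossings. -/
theorem twist_kink {ε : ℂ} (hε : ε * ε = 1) (f : Bool → Bool) {a b : Word} {D E : HDiagram a b}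
    (hD : D.crossings = 1) (hE : E.crossings = 0) {t t' : ℂ} (ht : t' = ε * t) :
    twist ε f a b (lin D - t • lin E) =
      ε • (lin (D.mapSigns f) - t' • lin (E.mapSigns f)) := by
  rw [twist_lin_sub_smul, hD, hE, pow_one, pow_zero, one_smul, smul_sub, smul_smul, ht,
    ← mul_assoc, hε, one_mul]

/-- The condition `hf` keeps opposite crossings opposite, as the Hecke relation and the second
Reidemeister moves need. The conditions `hq` and `hr` are what results from comparing coefficients
in the Hecke and kink relations. -/
theorem twistsRelations {ε : ℂ} (hε : ε * ε = 1) {f : Bool → Bool} (hf : ∀ s, f (!s) = !f s)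
    {q r q' r' δ : ℂ} (hq : q' - q'⁻¹ = cond (f true) ε (-ε) * (q - q⁻¹))
    (hr : ∀ s, kinkFactor r' (f s) = ε * kinkFactor r s) :
    TwistsRelations ε f q r q' r' δ := by
  intro a b y hy
  cases hy with
  | @isotopy a b D D' h =>
    -- Isotopic diagrams have permuted labels, hence equal crossing numbers, and a single power of
    -- `ε` factors out.
    exact ⟨_, _, .isotopy (h.relabel (bd := crossingWord) f),
      twist_lin_sub ε f h.labels_perm.length_eq⟩
  | hecke =>
    -- Each crossing contributes `ε`; if `f` flips the signs, the two crossings of the relation also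
    -- trade places, which gives the extra minus sign.
    refine ⟨cond (f true) ε (-ε), _, .hecke, ?_⟩
    have h1 : (crossing true).mapSigns f = crossing (f true) := rfl
    have h2 : (crossing false).mapSigns f = crossing (!f true) := by rw [← hf]; rfl
    have h3 : HDiagram.mapSigns f (Diagram.id [true, true]) = Diagram.id [true, true] := rfl
    have c (s : Bool) : (crossing s).crossings = 1 := rfl
    have c0 : HDiagram.crossings (Diagram.id [true, true]) = 0 := rfl
    rw [map_sub, map_sub, map_smul, twist_lin, twist_lin, twist_lin, h1, h2, h3, c, c, c0, hq]
    have e : ε ^ 2 = 1 := by rw [sq, hε]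
    cases f true
    · simp only [cond_false, Bool.not_false]
      match_scalars
      · ring
      · ring
      -- This is the coefficient of the two parallel strings: they acquire no `ε`, so the `ε` of the
      -- multiplier and the `ε` in `hq` must cancel as `ε ^ 2 = 1`.
      · linear_combination (q - q⁻¹) * e
    · simp only [cond_true, Bool.not_true]
      match_scalars
      · ring
      · ring
      · linear_combination (q - q⁻¹) * e
  | kinkRight_pos => exact ⟨ε, _, .kinkRight q' r' δ (f true), twist_kink hε f rfl rfl (hr true)⟩
  | kinkRight_neg => exact ⟨ε, _, .kinkRight q' r' δ (f false), twist_kink hε f rfl rfl (hr false)⟩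
  | kinkLeft_pos => exact ⟨ε, _, .kinkLeft q' r' δ (f true), twist_kink hε f rfl rfl (hr true)⟩
  | kinkLeft_neg => exact ⟨ε, _, .kinkLeft q' r' δ (f false), twist_kink hε f rfl rfl (hr false)⟩
  | reidemeister_two s =>
    refine ⟨1, _, .reidemeister_two (f s), ?_⟩
    -- Rewriting `!f s` as `f (!s)` makes the target relation the sign change of the given one, by
    -- computation.
    rw [← hf, map_sub, twist_lin, twist_lin, one_smul]
    have c : HDiagram.crossings ((crossing s).comp (crossing (!s))) = 2 := rfl
    rw [c, sq, hε, one_smul]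
    -- The parallel strings have no crossings, so their scalar `ε ^ 0` reduces to `1`.
    exact congrArg _ (one_smul ℂ _)
  | reidemeister_two_RL s =>
    refine ⟨1, _, .reidemeister_two_RL (f s), ?_⟩
    rw [← hf, map_sub, twist_lin, twist_lin, one_smul]
    have c : HDiagram.crossings ((crossingRL s).comp (crossingLR (!s))) = 2 := rfl
    rw [c, sq, hε, one_smul]
    exact congrArg _ (one_smul ℂ _)
  | reidemeister_two_LR s =>
    refine ⟨1, _, .reidemeister_two_LR (f s), ?_⟩
    rw [← hf, map_sub, twist_lin, twist_lin, one_smul]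
    have c : HDiagram.crossings ((crossingLR s).comp (crossingRL (!s))) = 2 := rfl
    rw [c, sq, hε, one_smul]
    exact congrArg _ (one_smul ℂ _)
  | reidemeister_three s => exact ⟨_, _, .reidemeister_three (f s), twist_lin_sub ε f rfl⟩
  | circle b =>
    refine ⟨1, _, .circle b, ?_⟩
    have c : (circle b).crossings = 0 := rfl
    have c0 : HDiagram.crossings (Diagram.id []) = 0 := rfl
    rw [twist_lin_sub_smul, c, c0, pow_zero, one_smul, one_smul, one_smul]
    rfl

/-! ### The induced isomorphism of planar algebras -/

section TwistEquiv

variable {ε : ℂ} {f : Bool → Bool} {q r q' r' δ : ℂ}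

/-- The map that a twist induces on the HOMFLY-PT spaces. -/
def twistMap (h : TwistsRelations ε f q r q' r' δ) (c : Color) :
    HSpace q r δ c →ₗ[ℂ] HSpace q' r' δ c :=
  Submodule.mapQ _ _ (twist ε f [] c.word) fun _ hx => twist_mem_skeinSubmodule h hx

theorem twistMap_mk (h : TwistsRelations ε f q r q' r' δ) {c : Color}
    (D : HDiagram [] c.word) :
    twistMap h c (HSpace.mk q r δ D) =
      ε ^ D.crossings • HSpace.mk q' r' δ (D.mapSigns f) := by
  exact congrArg Submodule.Quotient.mk (twist_lin ε f D)

theorem twistMap_twistMap (hε : ε * ε = 1) (hf : ∀ s, f (f s) = s)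
    (h : TwistsRelations ε f q r q' r' δ) (h' : TwistsRelations ε f q' r' q r δ) (c : Color)
    (x : HSpace q r δ c) : twistMap h' c (twistMap h c x) = x := by
  obtain ⟨x, rfl⟩ := Submodule.Quotient.mk_surjective _ x
  exact congrArg Submodule.Quotient.mk (twist_twist hε hf x)

/-- The isomorphism of HOMFLY-PT planar algebras that a twist induces. -/
def twistIso (hε : ε * ε = 1) (hf : ∀ s, f (f s) = s) (h : TwistsRelations ε f q r q' r' δ)
    (h' : TwistsRelations ε f q' r' q r δ) :
    PlanarAlgebra.Iso (homflyPT q r δ) (homflyPT q' r' δ) where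
  -- The inverse is the twist by the same `ε` and `f`, read with the two pairs of parameters
  -- exchanged.
  equiv c := LinearEquiv.ofLinearMap (twistMap h c) (twistMap h' c)
    (LinearMap.ext fun x => twistMap_twistMap hε hf h' h c x)
    (LinearMap.ext fun x => twistMap_twistMap hε hf h h' c x)
  equiv_act := by
    intro ι _ c o T v
    -- Both sides are multilinear in the inputs, so it suffices to compare them on classes of
    -- diagrams.
    have key : (twistMap h o).compMultilinearMap (act q r δ T) =
        (act q' r' δ T).compLinearMap fun i => twistMap h (c i) := by
      refine HSpace.ext_multilinear q r δ fun D => ?_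
      cases nonempty_fintype ι
      have hT : HDiagram.mapSigns f (T.diagram.subst D) =
          T.diagram.subst fun i => (D i).mapSigns f :=
        Diagram.subst_relabel (bd := crossingWord) f T.diagram D
      rw [LinearMap.compMultilinearMap_apply, MultilinearMap.compLinearMap_apply, act_mk]
      simp only [twistMap_mk]
      -- Multilinearity collects the scalars of the inputs into a product of powers of `ε`, which is
      -- the power for the total number of crossings.
      rw [MultilinearMap.map_smul_univ, act_mk, hT, T.crossings_subst, Finset.prod_pow_eq_pow_sum]
    exact DFunLike.congr_fun key v

theorem twistIso_diagramClass (hε : ε * ε = 1) (hf : ∀ s, f (f s) = s)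
    (h : TwistsRelations ε f q r q' r' δ) (h' : TwistsRelations ε f q' r' q r δ) {c : Color}
    (D : HDiagram [] c.word) :
    (twistIso hε hf h h').equiv c (diagramClass q r δ D) =
      ε ^ D.crossings • diagramClass q' r' δ (D.mapSigns f) :=
  twistMap_mk h D

end TwistEquiv

end

end Homfly

/-! ### The three changes of parameters -/

/-- The four HOMFLY-PT planar algebras are isomorphic; the isomorphisms are the identity
on diagrams, the negation of every crossing, and the replacement of every crossing by the
opposite one. -/
theorem proposition2p3 (q r δ : ℂ) (hq : q ≠ 0) (hr : r ≠ 0)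
    (hδ : r - r⁻¹ = δ * (q - q⁻¹)) :
    (∃ Φ : Homfly.PlanarAlgebra.Iso (Homfly.homflyPT q r δ) (Homfly.homflyPT (-q⁻¹) r δ),
      ∀ (c : Homfly.Color) (D : Homfly.HDiagram [] c.word),
        Φ.equiv c (Homfly.diagramClass q r δ D) = Homfly.diagramClass (-q⁻¹) r δ D) ∧
    (∃ Φ : Homfly.PlanarAlgebra.Iso (Homfly.homflyPT q r δ) (Homfly.homflyPT (-q) (-r) δ),
      ∀ (c : Homfly.Color) (D : Homfly.HDiagram [] c.word),
        Φ.equiv c (Homfly.diagramClass q r δ D) =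
          (-1 : ℂ) ^ D.crossings • Homfly.diagramClass (-q) (-r) δ D) ∧
    (∃ Φ : Homfly.PlanarAlgebra.Iso (Homfly.homflyPT q r δ) (Homfly.homflyPT q⁻¹ r⁻¹ δ),
      ∀ (c : Homfly.Color) (D : Homfly.HDiagram [] c.word),
        Φ.equiv c (Homfly.diagramClass q r δ D) =
          Homfly.diagramClass q⁻¹ r⁻¹ δ D.mirror) := by
  refine ⟨?_, ?_, ?_⟩
  -- Here `q - q⁻¹` is unchanged by `q ↦ -q⁻¹`, so the trivial twist works.
  · have e : (1 : ℂ) * 1 = 1 := one_mul 1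
    refine ⟨Homfly.twistIso (f := fun s => s) e (fun _ => rfl)
      (Homfly.twistsRelations (f := fun s => s) e (fun _ => rfl) ?_ fun s => ?_)
      (Homfly.twistsRelations (f := fun s => s) e (fun _ => rfl) ?_ fun s => ?_), fun c D => ?_⟩
    · simp [inv_neg]; ring
    · rw [one_mul]
    · simp [inv_neg]; ring
    · rw [one_mul]
    · rw [Homfly.twistIso_diagramClass, one_pow, one_smul, Homfly.HDiagram.mapSigns_id]
  -- Now `q - q⁻¹`, `r` and `r⁻¹` all change sign, which `ε = -1` absorbs.
  · have e : (-1 : ℂ) * -1 = 1 := by norm_num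
    refine ⟨Homfly.twistIso (f := fun s => s) e (fun _ => rfl)
      (Homfly.twistsRelations (f := fun s => s) e (fun _ => rfl) ?_ fun s => ?_)
      (Homfly.twistsRelations (f := fun s => s) e (fun _ => rfl) ?_ fun s => ?_), fun c D => ?_⟩
    · simp [inv_neg]; ring
    · cases s <;> simp [Homfly.kinkFactor, inv_neg]
    · simp [inv_neg]; ring
    · cases s <;> simp [Homfly.kinkFactor, inv_neg]
    · rw [Homfly.twistIso_diagramClass, Homfly.HDiagram.mapSigns_id]
  -- Inverting `q` negates `q - q⁻¹`, and inverting `r` interchanges the two kink factors; flipping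
  -- all crossings compensates both.
  · have e : (1 : ℂ) * 1 = 1 := one_mul 1
    refine ⟨Homfly.twistIso (f := fun s => !s) e Bool.not_not
      (Homfly.twistsRelations (f := fun s => !s) e (fun _ => rfl) ?_ fun s => ?_)
      (Homfly.twistsRelations (f := fun s => !s) e (fun _ => rfl) ?_ fun s => ?_), fun c D => ?_⟩
    · simp
    · cases s <;> simp [Homfly.kinkFactor]
    · simp
    · cases s <;> simp [Homfly.kinkFactor]
    · rw [Homfly.twistIso_diagramClass, one_pow, one_smul]
      rfl
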